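/- Complex spaces are Hausdorff, countable at infinity and not necessarily reduced. A complex space $X$ is called holomorphically convex if for every discrete sequence $(x_n)$ in $X$ (a sequence without cluster points) there is a holomorphic function $f:X\to\mathbb C$ with $\lim_{n\to\infty}|f(x_n)|=\infty$. Write $\Delta=\{z\in\mathbb C:|z|<1\}$, $S^1=\{z\in\mathbb C:|z|=1\}$ and $\Delta_{1+\epsilon}=\{z\in\mathbb C:|z|<1+\epsilon\}$. A complex space $X$ has the discrete disk property if, whenever $U\subset\mathbb C$ is an open neighbourhood of $\overline\Delta$ and $f_n:U\to X$ ($n\ge 1$) are holomorphic maps for which there are $\epsilon>0$ and a continuous map $\gamma:S^1\to X$ such that $\Delta_{1+\epsilon}\subset U$, the set $\bigcup_{n} f_n(\Delta_{1+\epsilon}\setminus\Delta)$ is relatively compact in $X$, and $f_n|_{S^1}$ converges uniformly to $\gamma$, the set $\bigcup_{n} f_n(\overline\Delta)$ is relatively compact in $X$. **Lemma.** Let $S$ be a complex space that has a holomorphically convex covering: there are a holomorphically convex complex space $\tilde S$ and a surjective unbranched holomorphic covering map $p:\tilde S\to S$. If $\Omega\subset\mathbb C$ is an open neighbourhood of $\overline\Delta$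 and $f_n:\Omega\to S$ ($n\ge 1$) is a sequence of holomorphic maps which converges uniformly on $S^1$ to a continuous map $\gamma:S^1\to S$, then $\bigcup_{n} f_n(\overline\Delta)$ is relatively compact in $S$. In particular, $S$ has the discrete disk property. -/

import Mathlib

open CategoryTheory AlgebraicGeometry TopologicalSpace Opposite
open scoped Manifold ContDiff Topology

noncomputable section

/-- A locally ringed space over `ℂ`: a locally ringed space together with a ring homomorphism
from `ℂ` to its global sections. By restriction this makes the structure sheaf a sheaf of
`ℂ`-algebras. -/
structure ComplexRingedSpace where
  toLRS : LocallyRingedSpace.{0}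
  scalars : CommRingCat.of ℂ ⟶ LocallyRingedSpace.Γ.obj (op toLRS)

namespace ComplexRingedSpace

/-- The underlying topological space. -/
abbrev Pt (X : ComplexRingedSpace) : Type := X.toLRS.toTopCat

/-- A morphism of locally ringed spaces over `ℂ`: a morphism of locally ringed spaces which is
`ℂ`-linear on sections. Between complex spaces these are exactly the holomorphic maps. -/
structure HolMap (X Y : ComplexRingedSpace) where
  toHom : X.toLRS ⟶ Y.toLRS
  scalars_comp : Y.scalars ≫ LocallyRingedSpace.Γ.map toHom.op = X.scalars

/-- The continuous map underlying a morphism. -/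
def HolMap.cont {X Y : ComplexRingedSpace} (f : HolMap X Y) : C(X.Pt, Y.Pt) :=
  f.toHom.base.hom

/-- The open subspace of `X` on the open set `U`. -/
def restrict (X : ComplexRingedSpace) (U : Opens X.Pt) : ComplexRingedSpace where
  toLRS := X.toLRS.restrict U.isOpenEmbedding
  scalars := X.scalars ≫ LocallyRingedSpace.Γ.map (X.toLRS.ofRestrict U.isOpenEmbedding).op

/-- A complex manifold `M` modelled on `E`, with its sheaf of holomorphic (that is, infinitely often
complex differentiable) functions. It is used only for `M = E` and for open subsets `M` of `E`,
where `E` is `ℂ` or `ℂⁿ`. -/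
def ofManifold (E M : Type) [NormedAddCommGroup E] [NormedSpace ℂ E] [TopologicalSpace M]
    [ChartedSpace E M] : ComplexRingedSpace where
  toLRS := ChartedSpace.locallyRingedSpace 𝓘(ℂ, E) M
  scalars := (show CommRingCat.of ℂ ⟶ CommRingCat.of C^∞⟮𝓘(ℂ, E), (⊤ : Opens M); 𝓘(ℂ), ℂ⟯ from
    CommRingCat.ofHom (algebraMap ℂ C^∞⟮𝓘(ℂ, E), (⊤ : Opens M); 𝓘(ℂ), ℂ⟯))

/-- The complex vector space `E` as a complex space. -/
abbrev affine (E : Type) [NormedAddCommGroup E] [NormedSpace ℂ E] : ComplexRingedSpace :=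
  ofManifold E E

/-- A presentation of `X` as an analytic model space: a `ℂ`-morphism `toMap : X → ℂⁿ`, an open set
`D` of `ℂⁿ` and finitely many holomorphic functions `f₁, …, f_k` on `D` such that `toMap` is a
homeomorphism onto the common zero set of the `f_j` in `D`, and such that for every point `x` of
`X` the map of local rings `𝒪_{ℂⁿ, toMap x} → 𝒪_{X, x}` is surjective with kernel the ideal generated
by the germs of the `f_j`.  Equivalently, `toMap` induces an isomorphism from `X` to the closed
subspace `(V, (𝒪_D / (f₁, …, f_k))|_V)` of `D`, where `V` is the zero set of `f₁, …, f_k`. -/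
structure ModelPresentation (X : ComplexRingedSpace) where
  /-- The dimension of the ambient space. -/
  n : ℕ
  toMap : HolMap X (affine (Fin n → ℂ))
  D : Opens (Fin n → ℂ)
  /-- The number of equations. -/
  k : ℕ
  f : Fin k → C^∞⟮𝓘(ℂ, Fin n → ℂ), D; 𝓘(ℂ), ℂ⟯
  mem_D : ∀ x : X.Pt, toMap.cont x ∈ D
  isEmbedding : Topology.IsEmbedding toMap.cont
  range_eq : Set.range toMap.cont =
    {z : Fin n → ℂ | ∃ hz : z ∈ D, ∀ j, f j ⟨z, hz⟩ = 0}
  surjective : ∀ x : X.Pt, Function.Surjective (toMap.toHom.stalkMap x)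
  ker_eq : ∀ x : X.Pt, RingHom.ker (toMap.toHom.stalkMap x).hom =
    Ideal.span (Set.range fun j =>
      (affine (Fin n → ℂ)).toLRS.presheaf.germ D (toMap.cont x) (mem_D x) (f j))

/-- Complex spaces, not necessarily reduced: Hausdorff locally ringed spaces over `ℂ` which are
countable at infinity and locally isomorphic to analytic model spaces. -/
structure IsComplexSpace (X : ComplexRingedSpace) : Prop where
  t2 : T2Space X.Pt
  sigmaCompact : SigmaCompactSpace X.Pt
  locallyModel : ∀ x : X.Pt, ∃ U : Opens X.Pt, x ∈ U ∧ Nonempty (ModelPresentation (X.restrict U))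

/-- An (unbranched) covering of complex spaces: a holomorphic map which is a surjective topological
covering map and a local isomorphism of ringed spaces. -/
structure HolMap.IsCovering {X Y : ComplexRingedSpace} (p : HolMap X Y) : Prop where
  surjective : Function.Surjective p.cont
  isCoveringMap : IsCoveringMap p.cont
  stalk_bijective : ∀ x : X.Pt, Function.Bijective (p.toHom.stalkMap x)

/-- `X` is holomorphically convex if for every discrete sequence (a sequence without cluster
points) there is a holomorphic function on `X` whose modulus tends to infinity along it. -/
def HolomorphicallyConvex (X : ComplexRingedSpace) : Prop :=
  ∀ x : ℕ → X.Pt, (∀ a, ¬ MapClusterPt a Filter.atTop x) →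
    ∃ f : HolMap X (affine ℂ),
      Filter.Tendsto (fun n => ‖(show ℂ from f.cont (x n))‖) Filter.atTop Filter.atTop

/-- An open subset `U` of `ℂ` as a complex space. -/
abbrev planeDomain (U : Opens ℂ) : ComplexRingedSpace :=
  ofManifold ℂ U

/-- The image under `f : U → X` of the part of the set `A` that lies in `U`. -/
def imageOn {X : ComplexRingedSpace} {U : Opens ℂ} (f : HolMap (planeDomain U) X) (A : Set ℂ) :
    Set X.Pt :=
  {y | ∃ z : U, (z : ℂ) ∈ A ∧ f.cont z = y}

/-- The restriction of `f : U → X` to the unit circle, for `U` containing the closed unit disk. -/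
def onCircle {X : ComplexRingedSpace} {U : Opens ℂ} (hU : Metric.closedBall (0 : ℂ) 1 ⊆ U)
    (f : HolMap (planeDomain U) X) : C(Metric.sphere (0 : ℂ) 1, X.Pt) :=
  f.cont.comp (⟨fun z => ⟨z, hU (Metric.sphere_subset_closedBall z.2)⟩, by fun_prop⟩ :
    C(Metric.sphere (0 : ℂ) 1, U))

/-- The maps `f m : U → X` converge uniformly to `γ` on the unit circle. As the circle is compact
and `γ` is continuous, uniform convergence for any metric (or uniformity) inducing the topology of
`X` is convergence in the compact-open topology. -/
def ConvergesOnCircle {X : ComplexRingedSpace} {U : Opens ℂ}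
    (hU : Metric.closedBall (0 : ℂ) 1 ⊆ U) (f : ℕ → HolMap (planeDomain U) X)
    (γ : C(Metric.sphere (0 : ℂ) 1, X.Pt)) : Prop :=
  Filter.Tendsto (fun m => onCircle hU (f m)) Filter.atTop (𝓝 γ)

/-- The subset `A` is relatively compact. -/
def RelativelyCompact {X : ComplexRingedSpace} (A : Set X.Pt) : Prop :=
  IsCompact (closure A)

/-- The discrete disk property. -/
def DiscreteDiskProperty (X : ComplexRingedSpace) : Prop :=
  ∀ (U : Opens ℂ) (hU : Metric.closedBall (0 : ℂ) 1 ⊆ U) (f : ℕ → HolMap (planeDomain U) X),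
    (∃ (ε : ℝ) (γ : C(Metric.sphere (0 : ℂ) 1, X.Pt)), 0 < ε ∧
      Metric.ball (0 : ℂ) (1 + ε) ⊆ U ∧
      RelativelyCompact (⋃ m, imageOn (f m) (Metric.ball 0 (1 + ε) \ Metric.ball 0 1)) ∧
      ConvergesOnCircle hU f γ) →
    RelativelyCompact (⋃ m, imageOn (f m) (Metric.closedBall 0 1))

end ComplexRingedSpace

end

/-! The disk is contractible, so each `f n` lifts to the covering. The maps on the circle, together
with their limit, form one homotopy over the compact space `OnePoint ℕ`; lifting it keeps all lifted
circles in one compact set `K` (`IsCoveringMap.exists_lifts_compact`). By the maximum principle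
(`norm_comp_lift_le`), a holomorphic function upstairs is bounded on all lifted disks by its bound
on `K`. Holomorphic convexity then gives every sequence in the lifted disks a cluster point, so they
lie in a compact set, whose image in `S` is compact. The lifts are only continuous maps;
`contMDiffAt_comp_lift` shows that holomorphic functions are still holomorphic along them, by
comparing values of sections. -/

namespace ComplexRingedSpace

/-! ### Values of sections and holomorphy along continuous lifts -/

/-- The constants in the local ring at `x`. -/
noncomputable def constStalk (X : ComplexRingedSpace) (x : X.Pt) :
    CommRingCat.of ℂ ⟶ X.toLRS.presheaf.stalk x :=
  X.scalars ≫ X.toLRS.presheaf.germ ⊤ x trivial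

/-- The section `s` takes the value `c` at `x`: the germ of `s - c` at `x` is not a unit. -/
def HasValueAt (X : ComplexRingedSpace) {V : Opens X.Pt} (s : X.toLRS.presheaf.obj (op V))
    (x : X.Pt) (c : ℂ) : Prop :=
  ∃ hx : x ∈ V, ¬ IsUnit (X.toLRS.presheaf.germ V x hx s - X.constStalk x c)

theorem constStalk_stalkMap {X Y : ComplexRingedSpace} (f : HolMap X Y) (x : X.Pt) :
    Y.constStalk (f.cont x) ≫ f.toHom.stalkMap x = X.constStalk x := by
  have h : X.constStalk x = Y.scalars ≫ LocallyRingedSpace.Γ.map f.toHom.op ≫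
      X.toLRS.presheaf.germ ⊤ x trivial := by
    rw [constStalk, ← f.scalars_comp]
    exact Category.assoc _ _ _
  rw [h]
  exact congrArg (Y.scalars ≫ ·) (LocallyRingedSpace.stalkMap_germ f.toHom ⊤ x trivial)

/-- The stalk map preserves constants, and being local it both preserves and reflects units. -/
theorem hasValueAt_pullback_iff {X Y : ComplexRingedSpace} (f : HolMap X Y) {V : Opens Y.Pt}
    (s : Y.toLRS.presheaf.obj (op V)) (x : X.Pt) (c : ℂ) :
    X.HasValueAt (V := (Opens.map f.toHom.base).obj V) (f.toHom.c.app (op V) s) x c ↔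
      Y.HasValueAt s (f.cont x) c := by
  have key (hx : f.cont x ∈ V) :
      X.toLRS.presheaf.germ ((Opens.map f.toHom.base).obj V) x hx (f.toHom.c.app (op V) s) -
        X.constStalk x c =
      f.toHom.stalkMap x (Y.toLRS.presheaf.germ V (f.cont x) hx s - Y.constStalk (f.cont x) c) := by
    refine Eq.trans ?_ (map_sub (f.toHom.stalkMap x).hom _ _).symm
    exact congrArg₂ (· - ·) (LocallyRingedSpace.stalkMap_germ_apply f.toHom V x hx s).symm
      (ConcreteCategory.congr_hom (constStalk_stalkMap f x) c).symm
  refine exists_congr fun hx => not_congr ?_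
  refine (iff_of_eq (congrArg IsUnit (key hx))).trans ?_
  exact isUnit_map_iff (f.toHom.stalkMap x).hom _

/-- A germ of a holomorphic function on a manifold is a unit exactly when its value at the point is
nonzero. -/
theorem hasValueAt_ofManifold_iff {E M : Type} [NormedAddCommGroup E] [NormedSpace ℂ E]
    [TopologicalSpace M] [ChartedSpace E M] {V : Opens M} (s : C^∞⟮𝓘(ℂ, E), V; 𝓘(ℂ), ℂ⟯)
    (x : M) (c : ℂ) :
    (ofManifold E M).HasValueAt (V := V) s x c ↔ ∃ hx : x ∈ V, s ⟨x, hx⟩ = c := by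
  refine exists_congr fun hx => ?_
  have h := smoothSheafCommRing.isUnit_stalk_iff 𝓘(ℂ, E) (M := M) (x := x)
    ((ofManifold E M).toLRS.presheaf.germ V x hx s - (ofManifold E M).constStalk x c)
  have h1 := smoothSheafCommRing.eval_germ (IM := 𝓘(ℂ, E)) (I := 𝓘(ℂ)) (R := ℂ) V x hx s
  have h2 := smoothSheafCommRing.eval_germ (IM := 𝓘(ℂ, E)) (I := 𝓘(ℂ)) (R := ℂ) ⊤ x trivial
    (algebraMap ℂ C^∞⟮𝓘(ℂ, E), (⊤ : Opens M); 𝓘(ℂ), ℂ⟯ c)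
  refine ((not_congr h).trans not_not).trans ?_
  have h3 := map_sub (smoothSheafCommRing.eval 𝓘(ℂ, E) 𝓘(ℂ) M ℂ x)
    ((ofManifold E M).toLRS.presheaf.germ V x hx s) ((ofManifold E M).constStalk x c)
  refine (iff_of_eq (congrArg (· = 0) (h3.trans (congrArg₂ (· - ·) h1 h2)))).trans ?_
  exact sub_eq_zero

/-- The coordinate function of `ℂ`. -/
def coordinate : C^∞⟮𝓘(ℂ, ℂ), (⊤ : Opens ℂ); 𝓘(ℂ), ℂ⟯ :=
  ⟨Subtype.val, contMDiff_subtype_val⟩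

/-- The global section corresponding to a holomorphic function. -/
noncomputable def HolMap.toSection {X : ComplexRingedSpace} (h : HolMap X (affine ℂ)) :
    X.toLRS.presheaf.obj (op ⊤) :=
  h.toHom.c.app (op ⊤) coordinate

theorem HolMap.hasValueAt_toSection {X : ComplexRingedSpace} (h : HolMap X (affine ℂ))
    (x : X.Pt) : X.HasValueAt h.toSection x (show ℂ from h.cont x) :=
  (hasValueAt_pullback_iff h (V := ⊤) _ x _).mpr
    ((hasValueAt_ofManifold_iff (V := ⊤) coordinate _ _).mpr ⟨trivial, rfl⟩)

theorem HasValueAt.of_germ_eq {X : ComplexRingedSpace} {V W : Opens X.Pt}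
    {s : X.toLRS.presheaf.obj (op V)} {t : X.toLRS.presheaf.obj (op W)} {x : X.Pt} {c : ℂ}
    (h : X.HasValueAt s x c) (hV : x ∈ V) (hW : x ∈ W)
    (hst : X.toLRS.presheaf.germ V x hV s = X.toLRS.presheaf.germ W x hW t) :
    X.HasValueAt t x c := by
  obtain ⟨_, h⟩ := h
  exact ⟨hW, hst ▸ h⟩

/-- A preimage of the germ of `s` under the stalk map is represented by some `t`; equality of germs
at `x` spreads to a neighbourhood. -/
theorem exists_pullback_eventually_germ_eq {X Y : ComplexRingedSpace} (p : HolMap X Y) (x : X.Pt)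
    (hp : Function.Surjective (p.toHom.stalkMap x)) (s : X.toLRS.presheaf.obj (op ⊤)) :
    ∃ (V : Opens Y.Pt) (_ : p.cont x ∈ V) (t : Y.toLRS.presheaf.obj (op V)) (W : Opens X.Pt)
      (_ : x ∈ W), ∀ y ∈ W, ∃ hy : y ∈ (Opens.map p.toHom.base).obj V,
        X.toLRS.presheaf.germ ⊤ y trivial s =
          X.toLRS.presheaf.germ _ y hy (p.toHom.c.app (op V) t) := by
  obtain ⟨τ, hτ⟩ := hp (X.toLRS.presheaf.germ ⊤ x trivial s)
  obtain ⟨V, hV, t, rfl⟩ := Y.toLRS.presheaf.exists_germ_eq τ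
  have h := hτ.symm.trans (LocallyRingedSpace.stalkMap_germ_apply p.toHom V x hV t)
  obtain ⟨W, hW, i, j, hij⟩ := X.toLRS.presheaf.germ_eq (U := ⊤)
    (V := (Opens.map p.toHom.base).obj V) x trivial hV _ _ h
  refine ⟨V, hV, t, W, hW, fun y hy => ⟨j.le hy, ?_⟩⟩
  rw [← X.toLRS.presheaf.germ_res_apply i y hy, hij, X.toLRS.presheaf.germ_res_apply j y hy]

/-- Holomorphic functions on `X` are locally pulled back along `p`, so that they are holomorphic
along continuous lifts of holomorphic maps. -/
theorem contMDiffAt_comp_lift {E M : Type} [NormedAddCommGroup E] [NormedSpace ℂ E]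
    [TopologicalSpace M] [ChartedSpace E M] {X Y : ComplexRingedSpace} (p : HolMap X Y)
    (f : HolMap (ofManifold E M) Y) (h : HolMap X (affine ℂ)) {g : M → X.Pt} {z : M}
    (hp : Function.Surjective (p.toHom.stalkMap (g z)))
    (hg : ContinuousAt g z) (hgf : ∀ᶠ w in 𝓝 z, p.cont (g w) = f.cont w) :
    ContMDiffAt 𝓘(ℂ, E) 𝓘(ℂ) ∞ (fun w => (show ℂ from h.cont (g w))) z := by
  obtain ⟨V, hV, t, W, hW, hVW⟩ := exists_pullback_eventually_germ_eq p (g z) hp h.toSection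
  let Z : Opens M := (Opens.map f.toHom.base).obj V
  let u : C^∞⟮𝓘(ℂ, E), Z; 𝓘(ℂ), ℂ⟯ := f.toHom.c.app (op V) t
  -- The value of `h` at `g w` is that of `t` at `p (g w) = f w`, hence that of the pullback `u` at
  -- `w`.
  have hu : ∀ᶠ w in 𝓝 z, ∃ hw : w ∈ Z, u ⟨w, hw⟩ = (show ℂ from h.cont (g w)) := by
    filter_upwards [hgf, hg (W.isOpen.mem_nhds hW)] with w hw hwW
    obtain ⟨hy, hgerm⟩ := hVW _ hwW
    have := (h.hasValueAt_toSection (g w)).of_germ_eq trivial hy hgerm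
    rw [hasValueAt_pullback_iff, hw] at this
    have := (hasValueAt_pullback_iff f t w _).mpr this
    exact (hasValueAt_ofManifold_iff _ _ _).mp this
  obtain ⟨hz, -⟩ := hu.self_of_nhds
  have := (contMDiffAt_subtype_iff (U := Z) (x := ⟨z, hz⟩)
    (I := 𝓘(ℂ, E)) (I' := 𝓘(ℂ)) (n := ∞) (f := fun w => (show ℂ from h.cont (g w)))).mp
  refine this ((u.contMDiff ⟨z, hz⟩).congr_of_eventuallyEq ?_)
  filter_upwards [continuousAt_subtype_val hu] with w hw
  exact hw.2.symm

end ComplexRingedSpace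

/-! ### Lifting convergent sequences of disks to a covering -/

/-- A sequence of points converging to `p e` lifts to a sequence converging to `e`. -/
theorem IsLocalHomeomorph.exists_lift_seq {X Y : Type*} [TopologicalSpace X] [TopologicalSpace Y]
    {p : X → Y} (hp : IsLocalHomeomorph p) (hsurj : Function.Surjective p) {u : OnePoint ℕ → Y}
    (hu : Continuous u) : ∃ v : OnePoint ℕ → X, Continuous v ∧ ∀ n, p (v n) = u n := by
  classical
  obtain ⟨e, he⟩ := hsurj (u OnePoint.infty)
  obtain ⟨φ, heφ, rfl⟩ := hp e
  have hu' := (OnePoint.continuous_iff_from_nat u).mp hu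
  -- Outside the chart any preimage will do: this concerns only finitely many terms.
  let v : OnePoint ℕ → X := fun n =>
    if u n ∈ φ.target then φ.symm (u n) else Function.surjInv hsurj (u n)
  have hinf : u OnePoint.infty ∈ φ.target := he ▸ φ.map_source heφ
  have hnhds : φ.target ∈ 𝓝 (u OnePoint.infty) := φ.open_target.mem_nhds hinf
  refine ⟨v, (OnePoint.continuous_iff_from_nat v).mpr ?_, fun n => ?_⟩
  · have hlim := (φ.continuousAt_symm hinf).tendsto.comp hu'
    rw [show v OnePoint.infty = φ.symm (u OnePoint.infty) from if_pos hinf]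
    refine hlim.congr' ?_
    filter_upwards [hu' hnhds] with n hn
    exact (if_pos hn).symm
  · by_cases hn : u n ∈ φ.target
    · rw [show v n = φ.symm (u n) from if_pos hn, φ.right_inv hn]
    · rw [show v n = Function.surjInv hsurj (u n) from if_neg hn, Function.surjInv_eq hsurj]

/-- A convergent sequence of loops `f n ∘ c`, each the restriction of a map on a contractible
space, can be lifted to a covering space with values in a compact set. -/
theorem IsCoveringMap.exists_lifts_compact {X Y A : Type*} [TopologicalSpace X]
    [TopologicalSpace Y] [TopologicalSpace A] {p : X → Y} (hp : IsCoveringMap p)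
    (hsurj : Function.Surjective p) (f : ℕ → C(A, Y)) (c : C(unitInterval, A))
    (contr : C(unitInterval × A, A)) (hcontr0 : ∀ a, contr (0, a) = c 0)
    (hcontr1 : ∀ a, contr (1, a) = a) (hcontr : ∀ s, contr (s, c 0) = c 0) {γ : C(unitInterval, Y)}
    (hγ : Filter.Tendsto (fun n => (f n).comp c) Filter.atTop (𝓝 γ)) :
    ∃ (g : ℕ → C(A, X)) (K : Set X), IsCompact K ∧ (∀ n a, p (g n a) = f n a) ∧
      ∀ n t, g n (c t) ∈ K := by
  let F : OnePoint ℕ → C(unitInterval, Y) := fun n => n.elim γ fun n => (f n).comp c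
  have hF : Continuous F := (OnePoint.continuous_iff_from_nat F).mpr hγ
  let H : C(unitInterval × OnePoint ℕ, Y) :=
    ⟨fun q => F q.2 q.1, by
      exact ContinuousEval.continuous_eval.comp (by fun_prop :
        Continuous fun q : unitInterval × OnePoint ℕ => (F q.2, q.1))⟩
  obtain ⟨v, hv, hpv⟩ := hp.isLocalHomeomorph.exists_lift_seq hsurj
    (u := fun n => F n 0) (by fun_prop)
  let L := hp.liftHomotopy H ⟨v, hv⟩ (fun n => (hpv n).symm)
  have hL : ∀ q, p (L q) = H q := congrFun (hp.liftHomotopy_lifts H ⟨v, hv⟩ _)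
  have hL0 : ∀ n, L (0, n) = v n := hp.liftHomotopy_zero H ⟨v, hv⟩ _
  -- Lifting along the contraction, starting from the constant map `v n`, yields at time 1 a lift of
  -- `f n` itself.
  let G : ℕ → C(unitInterval × A, X) := fun n =>
    hp.liftHomotopy ((f n).comp contr) (.const A (v n)) fun a => by
      simpa [hcontr0, F] using (hpv n).symm
  have hG : ∀ n q, p (G n q) = f n (contr q) := fun n => congrFun (hp.liftHomotopy_lifts _ _ _)
  have hG0 : ∀ n a, G n (0, a) = v n := fun n => hp.liftHomotopy_zero _ _ _
  let g : ℕ → C(A, X) := fun n => (G n).comp ((ContinuousMap.const A 1).prodMk (.id A))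
  have hg : ∀ n a, p (g n a) = f n a := fun n a => (hG n (1, a)).trans (by rw [hcontr1])
  refine ⟨g, Set.range L, isCompact_range L.continuous, hg, fun n t => ?_⟩
  -- The contraction fixes `c 0`, so this track lifts a constant path and is constant. Uniqueness of
  -- path lifting then identifies `g n ∘ c` with a slice of `L`.
  have hg0 : g n (c 0) = v n := by
    have : (fun s => G n (s, c 0)) = fun _ => v n := by
      refine hp.eq_of_comp_eq (by fun_prop) (by fun_prop) ?_ 0 (hG0 n _)
      funext s
      exact ((hG n (s, c 0)).trans (congrArg (f n) (hcontr s))).trans (hpv n).symm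
    exact congrFun this 1
  have : (fun t => g n (c t)) = fun t => L (t, n) := by
    refine hp.eq_of_comp_eq (by fun_prop) (by fun_prop) ?_ 0 (hg0.trans (hL0 n).symm)
    funext t
    exact (hg n (c t)).trans (hL (t, n)).symm
  exact ⟨(t, n), (congrFun this t).symm⟩

/-! ### Compactness in complex spaces -/

/-- In a `σ`-compact locally compact space, a set in which every sequence has a cluster point
in the space is contained in a compact set. -/
theorem exists_isCompact_superset_of_mapClusterPt {X : Type*} [TopologicalSpace X]
    [SigmaCompactSpace X] [WeaklyLocallyCompactSpace X] {A : Set X}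
    (hA : ∀ x : ℕ → X, (∀ n, x n ∈ A) → ∃ a, MapClusterPt a Filter.atTop x) :
    ∃ K, IsCompact K ∧ A ⊆ K := by
  by_contra! h
  let E : CompactExhaustion X := default
  have (n : ℕ) : ∃ x ∈ A, x ∉ E n := Set.not_subset.mp (h _ (E.isCompact n))
  choose x hxA hxE using this
  obtain ⟨a, ha⟩ := hA x hxA
  obtain ⟨N, hN⟩ := E.exists_mem_nhds a
  obtain ⟨n, hn, hnN⟩ := Filter.frequently_atTop.mp (ha.frequently hN) N
  exact hxE n (E.subset hn hnN)

namespace ComplexRingedSpace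

/-- The model is a closed subset of the open set `D`, being the zero set of continuous functions. -/
theorem ModelPresentation.locallyCompactSpace {X : ComplexRingedSpace} (m : ModelPresentation X) :
    LocallyCompactSpace X.Pt := by
  let F : m.D → Fin m.k → ℂ := fun z j => m.f j z
  have hF : Continuous F := continuous_pi fun j => (m.f j).contMDiff.continuous
  have : LocallyCompactSpace m.D := m.D.isOpen.isOpenEmbedding_subtypeVal.locallyCompactSpace
  let φ : X.Pt → m.D := fun x => ⟨m.toMap.cont x, m.mem_D x⟩
  have hφ : Topology.IsEmbedding φ := m.isEmbedding.codRestrict (m.D : Set (Fin m.n → ℂ)) m.mem_D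
  have hrange : Set.range φ = F ⁻¹' {0} := by
    ext z
    have := Set.ext_iff.mp m.range_eq (z : Fin m.n → ℂ)
    constructor
    · rintro ⟨x, rfl⟩
      obtain ⟨_, h⟩ := (Set.ext_iff.mp m.range_eq (m.toMap.cont x)).mp ⟨x, rfl⟩
      exact funext h
    · intro hz
      obtain ⟨x, hx⟩ := this.mpr ⟨z.2, fun j => congrFun hz j⟩
      exact ⟨x, Subtype.ext hx⟩
  exact (Topology.IsClosedEmbedding.mk hφ
    (hrange ▸ isClosed_singleton.preimage hF)).locallyCompactSpace

theorem IsComplexSpace.weaklyLocallyCompactSpace {X : ComplexRingedSpace} (hX : X.IsComplexSpace) :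
    WeaklyLocallyCompactSpace X.Pt := by
  refine ⟨fun x => ?_⟩
  obtain ⟨U, hxU, ⟨m⟩⟩ := hX.locallyModel x
  have : LocallyCompactSpace U := m.locallyCompactSpace
  obtain ⟨K, hK, hKx⟩ := exists_compact_mem_nhds (⟨x, hxU⟩ : U)
  exact ⟨Subtype.val '' K, hK.image continuous_subtype_val,
    U.isOpen.isOpenEmbedding_subtypeVal.isOpenMap.image_mem_nhds hKx⟩

end ComplexRingedSpace

/-! ### The boundary loop and contraction of the disk -/

/-- The loop winding once around the unit circle. -/
noncomputable def unitCircleLoop : C(unitInterval, Metric.closedBall (0 : ℂ) 1) :=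
  ⟨fun t => ⟨Complex.exp ((2 * Real.pi * t : ℝ) * Complex.I), by
    rw [mem_closedBall_zero_iff, Complex.norm_exp_ofReal_mul_I]⟩, by fun_prop⟩

theorem norm_unitCircleLoop (t : unitInterval) : ‖(unitCircleLoop t : ℂ)‖ = 1 :=
  Complex.norm_exp_ofReal_mul_I _

theorem unitCircleLoop_zero : (unitCircleLoop 0 : ℂ) = 1 := by
  simp [unitCircleLoop]

theorem exists_unitCircleLoop_eq {z : ℂ} (hz : ‖z‖ = 1) : ∃ t, (unitCircleLoop t : ℂ) = z := by
  obtain ⟨t, ht, rfl⟩ : ∃ t ∈ Set.Ico (0 : ℝ) (2 * Real.pi), Complex.exp (t * Complex.I) = z := by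
    have harg : Complex.exp (z.arg * Complex.I) = z := by
      simpa [hz] using Complex.norm_mul_exp_arg_mul_I z
    have hle := z.arg_le_pi
    have hlt := z.neg_pi_lt_arg
    rcases le_or_gt 0 z.arg with h | h
    · exact ⟨z.arg, ⟨h, by linarith [Real.pi_pos]⟩, harg⟩
    · refine ⟨z.arg + 2 * Real.pi, ⟨by linarith, by linarith⟩, ?_⟩
      push_cast
      rw [add_mul, Complex.exp_add, harg, Complex.exp_two_pi_mul_I, mul_one]
  have hpi := Real.two_pi_pos
  refine ⟨⟨t / (2 * Real.pi), by have := ht.1; positivity, (div_le_one hpi).mpr ht.2.le⟩, ?_⟩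
  simp only [unitCircleLoop, ContinuousMap.coe_mk]
  rw [mul_div_cancel₀ _ hpi.ne']

/-- The contraction of the closed unit disk to the point `1` along segments. -/
noncomputable def closedDiskContraction :
    C(unitInterval × Metric.closedBall (0 : ℂ) 1, Metric.closedBall (0 : ℂ) 1) :=
  ⟨fun q => ⟨(1 - (q.1 : ℝ)) • (1 : ℂ) + (q.1 : ℝ) • (q.2 : ℂ),
    convex_closedBall (0 : ℂ) 1 (by simp) q.2.2 (by simpa using q.1.2.2) q.1.2.1 (by ring)⟩,
    by fun_prop⟩

/-! ### Maximum principle and conclusion -/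

namespace ComplexRingedSpace

/-- Maximum principle for holomorphic functions along lifts of holomorphic disks. -/
theorem norm_comp_lift_le {X Y : ComplexRingedSpace} (p : HolMap X Y)
    (hp : ∀ x, Function.Surjective (p.toHom.stalkMap x)) {Ω : Opens ℂ}
    (hΩ : Metric.closedBall (0 : ℂ) 1 ⊆ Ω) (f : HolMap (planeDomain Ω) Y)
    (g : C(Metric.closedBall (0 : ℂ) 1, X.Pt)) (hg : ∀ z, p.cont (g z) = f.cont ⟨z, hΩ z.2⟩)
    (h : HolMap X (affine ℂ)) {C : ℝ}
    (hC : ∀ z : Metric.closedBall (0 : ℂ) 1, ‖(z : ℂ)‖ = 1 →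
      ‖(show ℂ from h.cont (g z))‖ ≤ C)
    (z : Metric.closedBall (0 : ℂ) 1) : ‖(show ℂ from h.cont (g z))‖ ≤ C := by
  classical
  -- The value `g z` off the closed disk is arbitrary.
  let G : ℂ → X.Pt := fun w => if hw : w ∈ Metric.closedBall (0 : ℂ) 1 then g ⟨w, hw⟩ else g z
  have hGg (w : Metric.closedBall (0 : ℂ) 1) : G w = g w := dif_pos w.2
  have hG : ContinuousOn G (Metric.closedBall 0 1) :=
    continuousOn_iff_continuous_domRestrict.mpr (g.continuous.congr fun w => (hGg w).symm)
  let H : X.Pt → ℂ := fun x => h.cont x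
  have hH : Continuous H := h.cont.continuous
  have hdiff : DifferentiableOn ℂ (H ∘ G) (Metric.ball 0 1) := by
    intro w hw
    have hwc := Metric.ball_subset_closedBall hw
    have hnhds : Metric.closedBall (0 : ℂ) 1 ∈ 𝓝 w :=
      Filter.mem_of_superset (Metric.isOpen_ball.mem_nhds hw) Metric.ball_subset_closedBall
    have hGw : ContinuousAt (fun w : Ω => G w) ⟨w, hΩ hwc⟩ :=
      ContinuousAt.comp (f := Subtype.val) (g := G) (hG.continuousAt hnhds) continuousAt_subtype_val
    have := contMDiffAt_comp_lift (E := ℂ) (M := Ω) p f h (hp _) hGw (by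
      filter_upwards [continuousAt_subtype_val hnhds] with v hv
      exact (congrArg p.cont (hGg ⟨v, hv⟩)).trans (hg ⟨v, hv⟩))
    have := (contMDiffAt_subtype_iff (U := Ω) (x := ⟨w, hΩ hwc⟩)
      (I := 𝓘(ℂ, ℂ)) (I' := 𝓘(ℂ)) (n := ∞) (f := H ∘ G)).mp this
    exact (this.contDiffAt.differentiableAt (by simp)).differentiableWithinAt
  have hcl : DiffContOnCl ℂ (H ∘ G) (Metric.ball 0 1) :=
    ⟨hdiff, by rw [closure_ball _ one_ne_zero]; exact hH.comp_continuousOn hG⟩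
  have key := Complex.norm_le_of_forall_mem_frontier_norm_le (C := C) Metric.isBounded_ball hcl
    (fun w hw => by
      rw [frontier_ball _ one_ne_zero, mem_sphere_zero_iff_norm] at hw
      have hwc : w ∈ Metric.closedBall (0 : ℂ) 1 := mem_closedBall_zero_iff.mpr hw.le
      have : (H ∘ G) w = H (g ⟨w, hwc⟩) := congrArg H (hGg ⟨w, hwc⟩)
      rw [this]
      exact hC ⟨w, hwc⟩ hw)
    (z := z) (by rw [closure_ball _ one_ne_zero]; exact z.2)
  rwa [Function.comp_apply, hGg] at key

theorem relativelyCompact_of_isCompact {X : ComplexRingedSpace} (hX : X.IsComplexSpace)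
    {A K : Set X.Pt} (hK : IsCompact K) (hA : A ⊆ K) : RelativelyCompact A :=
  have := hX.t2
  hK.of_isClosed_subset isClosed_closure (closure_minimal hA hK.isClosed)

theorem relativelyCompact_iUnion_imageOn_closedBall {S St : ComplexRingedSpace}
    (hS : S.IsComplexSpace) (hSt : St.IsComplexSpace) (p : HolMap St S) (hp : p.IsCovering)
    (hconv : St.HolomorphicallyConvex) (Ω : Opens ℂ) (hΩ : Metric.closedBall (0 : ℂ) 1 ⊆ Ω)
    (f : ℕ → HolMap (planeDomain Ω) S) (γ : C(Metric.sphere (0 : ℂ) 1, S.Pt))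
    (hγ : ConvergesOnCircle hΩ f γ) :
    RelativelyCompact (⋃ m, imageOn (f m) (Metric.closedBall 0 1)) := by
  have := hSt.sigmaCompact
  have := hSt.weaklyLocallyCompactSpace
  let ι : C(Metric.closedBall (0 : ℂ) 1, Ω) := ⟨fun z => ⟨z, hΩ z.2⟩, by fun_prop⟩
  let c : C(unitInterval, Metric.sphere (0 : ℂ) 1) :=
    ⟨fun t => ⟨unitCircleLoop t, mem_sphere_zero_iff_norm.mpr (norm_unitCircleLoop t)⟩,
      by fun_prop⟩
  obtain ⟨g, K, hK, hg, hgK⟩ := hp.isCoveringMap.exists_lifts_compact hp.surjective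
    (fun n => (f n).cont.comp ι) unitCircleLoop closedDiskContraction
    (fun a => Subtype.ext (by simp [closedDiskContraction, unitCircleLoop_zero]))
    (fun a => Subtype.ext (by simp [closedDiskContraction]))
    (fun s => Subtype.ext (by simp [closedDiskContraction, unitCircleLoop_zero]))
    (γ := γ.comp c) (((ContinuousMap.continuous_precomp c).tendsto γ).comp hγ)
  obtain ⟨L, hL, hgL⟩ := exists_isCompact_superset_of_mapClusterPt
    (A := ⋃ n, Set.range (g n)) (fun x hx => by
      -- Without cluster points, some `h` is unbounded along the sequence, yet the maximum principle
      -- bounds it by `C`, its bound on `K`.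
      by_contra! hcl
      obtain ⟨h, hh⟩ := hconv x hcl
      obtain ⟨C, hC⟩ := hK.exists_bound_of_continuousOn (f := fun x => (show ℂ from h.cont x))
        (show Continuous fun x => (show ℂ from h.cont x) from h.cont.continuous).continuousOn
      obtain ⟨k, hk⟩ := (hh.eventually_gt_atTop C).exists
      obtain ⟨n, z, hz⟩ := Set.mem_iUnion.mp (hx k)
      refine hk.not_ge ?_
      rw [← hz]
      refine norm_comp_lift_le p (fun x => (hp.stalk_bijective x).2) hΩ (f n) (g n) (hg n) h
        (fun w hw => hC _ ?_) z
      obtain ⟨t, ht⟩ := exists_unitCircleLoop_eq hw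
      exact (Subtype.ext ht : unitCircleLoop t = w) ▸ hgK n t)
  refine relativelyCompact_of_isCompact hS (hL.image p.cont.continuous) ?_
  refine Set.iUnion_subset fun n => ?_
  rintro y ⟨z, hz, rfl⟩
  exact ⟨g n ⟨z, hz⟩, hgL (Set.mem_iUnion.mpr ⟨n, _, rfl⟩), hg n ⟨z, hz⟩⟩

end ComplexRingedSpace

theorem lemma3p3 (S St : ComplexRingedSpace)
    (hS : S.IsComplexSpace) (hSt : St.IsComplexSpace)
    (p : ComplexRingedSpace.HolMap St S) (hp : p.IsCovering)
    (hconv : St.HolomorphicallyConvex) :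
    (∀ (Ω : TopologicalSpace.Opens ℂ) (hΩ : Metric.closedBall (0 : ℂ) 1 ⊆ Ω)
      (f : ℕ → ComplexRingedSpace.HolMap (ComplexRingedSpace.planeDomain Ω) S),
      (∃ γ : C(Metric.sphere (0 : ℂ) 1, S.Pt), ComplexRingedSpace.ConvergesOnCircle hΩ f γ) →
      ComplexRingedSpace.RelativelyCompact
        (⋃ m, ComplexRingedSpace.imageOn (f m) (Metric.closedBall 0 1))) ∧
    S.DiscreteDiskProperty :=
  have main := fun Ω hΩ f γ hγ =>
    ComplexRingedSpace.relativelyCompact_iUnion_imageOn_closedBall hS hSt p hp hconv Ω hΩ f γ hγ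
  ⟨fun Ω hΩ f ⟨γ, hγ⟩ => main Ω hΩ f γ hγ, fun U hU f ⟨_, γ, _, _, _, hγ⟩ => main U hU f γ hγ⟩
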